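/- Let $d\ge 0$ be an integer, let $P$ be a Borel probability measure on $\mathbb{R}^d$ (with the Euclidean norm $\|\cdot\|$), let $\mathbb{X}\subset\mathbb{R}^d$ be a fixed subset, and write $B(x,r)=\{y:\|y-x\|<r\}$. The volume dimension of $P$ is $$d_{\mathrm{vol}}:=\sup\Big\{\nu\ge 0:\ \limsup_{r\to 0^+}\ \sup_{x\in\mathbb{X}}\frac{P(B(x,r))}{r^{\nu}}<\infty\Big\}.$$ Suppose that $0<d_{\mathrm{vol}}<\infty$ and that $$\sup_{x\in\mathbb{X}}\ \liminf_{r\to 0^+}\frac{P(B(x,r))}{r^{d_{\mathrm{vol}}}}>0 .$$ Let $K:\mathbb{R}^d\to\mathbb{R}$ be a bounded Borel measurable function with $$\int_0^\infty t^{d_{\mathrm{vol}}-1}\sup_{\|x\|\ge t}|K(x)|\,dt<\infty\qquad\text{and}\qquad \lim_{t\to 0^+}\ \inf_{\|x\|\le t}K(x)>0 .$$ For an i.i.d. sample $X_1,\dots,X_n$ from $P$ and a bandwidth $h>0$ put $$\hat p_h(x)=\frac{1}{nh^d}\sum_{i=1}^n K\Big(\frac{x-X_i}{h}\Big),\qquad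 p_h(x)=\mathbb{E}[\hat p_h(x)] .$$ Then there is a constant $h_{P,K}>0$, depending only on $P$ and $K$ (and on $\mathbb{X}$), and for every $\delta\in(0,1)$ a constant $C_{P,K,\delta}>0$, depending only on $P$, $K$ and $\delta$ (and on $\mathbb{X}$), such that the following holds. For every sequence $(h_n)$ of positive numbers with $\lim_n n h_n^{d_{\mathrm{vol}}}=\infty$ there is an $N$ such that, for every $n\ge N$ with $h_n\le h_{P,K}$, with probability at least $1-\delta$, $$\sup_{x\in\mathbb{X}}\big|\hat p_{h_n}(x)-p_{h_n}(x)\big|\ \ge\ C_{P,K,\delta}\sqrt{\frac{1}{n h_n^{2d-d_{\mathrm{vol}}}}}\,.$$ (The probability is understood as an inner probability: the inequality holds on a measurable set of samples of probability at least $1-\delta$.) -/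

import Mathlib

open MeasureTheory Filter Topology

noncomputable section

namespace KernelDensity

/-- `limsup_{r → 0⁺} sup_{x ∈ 𝕏} P(B(x, r)) / r ^ ν`, with `B(x, r)` the open Euclidean ball,
as an element of `[0, ∞]`. -/
def upperBallRate {d : ℕ} (𝕏 : Set (EuclideanSpace ℝ (Fin d)))
    (P : Measure (EuclideanSpace ℝ (Fin d))) (ν : ℝ) : ENNReal :=
  limsup (fun r : ℝ => ⨆ x ∈ 𝕏, P (Metric.ball x r) / ENNReal.ofReal (r ^ ν)) (𝓝[>] 0)

/-- The volume dimension of `P` relative to `𝕏`: the supremum of all `ν ≥ 0` for which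
`limsup_{r → 0⁺} sup_{x ∈ 𝕏} P(B(x, r)) / r ^ ν < ∞`.
The set always contains `0`; if it is unbounded (the volume dimension is infinite), the value of
the real `sSup` is `0`, so `0 < volDim 𝕏 P` says that the supremum is finite and positive. -/
def volDim {d : ℕ} (𝕏 : Set (EuclideanSpace ℝ (Fin d)))
    (P : Measure (EuclideanSpace ℝ (Fin d))) : ℝ :=
  sSup {ν : ℝ | 0 ≤ ν ∧ upperBallRate 𝕏 P ν < ⊤}

/-- `sup_{x ∈ 𝕏} liminf_{r → 0⁺} P(B(x, r)) / r ^ d_vol > 0`. -/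
def ExactLower {d : ℕ} (𝕏 : Set (EuclideanSpace ℝ (Fin d)))
    (P : Measure (EuclideanSpace ℝ (Fin d))) : Prop :=
  0 < ⨆ x ∈ 𝕏, liminf
    (fun r : ℝ => P (Metric.ball x r) / ENNReal.ofReal (r ^ volDim 𝕏 P)) (𝓝[>] 0)

/-- The integrability condition on the kernel with exponent `k`: `K` is bounded, and either
`d_vol = 0` or `∫₀^∞ t ^ (d_vol - 1) sup_{‖x‖ ≥ t} |K x| ^ k dt < ∞`
(the integrand takes values in `[0, ∞]`). -/
def KernelIntegrable {d : ℕ} (𝕏 : Set (EuclideanSpace ℝ (Fin d)))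
    (P : Measure (EuclideanSpace ℝ (Fin d))) (K : EuclideanSpace ℝ (Fin d) → ℝ) (k : ℝ) : Prop :=
  (∃ M : ℝ, ∀ x, |K x| ≤ M) ∧
    (volDim 𝕏 P = 0 ∨
      ∫⁻ t in Set.Ioi (0 : ℝ), ENNReal.ofReal (t ^ (volDim 𝕏 P - 1)) *
        (⨆ (x : EuclideanSpace ℝ (Fin d)) (_ : t ≤ ‖x‖), ENNReal.ofReal (|K x| ^ k)) < ⊤)

/-- `lim_{t → 0⁺} inf_{‖x‖ ≤ t} K x > 0`. -/
def PositiveNearOrigin {d : ℕ} (K : EuclideanSpace ℝ (Fin d) → ℝ) : Prop :=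
  ∃ L : ℝ, 0 < L ∧
    Tendsto (fun t : ℝ => ⨅ x : Metric.closedBall (0 : EuclideanSpace ℝ (Fin d)) t,
      K (x : EuclideanSpace ℝ (Fin d))) (𝓝[>] 0) (𝓝 L)

/-- The law `P ⊗ ⋯ ⊗ P` of an i.i.d. sample `(X₁, …, Xₙ)` from `P`. -/
def sampleLaw {d : ℕ} (P : Measure (EuclideanSpace ℝ (Fin d))) (n : ℕ) :
    Measure (Fin n → EuclideanSpace ℝ (Fin d)) :=
  Measure.pi fun _ => P

/-- The kernel density estimator `p̂_h(x) = (1 / (n h ^ d)) ∑ᵢ K((x - Xᵢ) / h)`. -/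
def kde {d n : ℕ} (K : EuclideanSpace ℝ (Fin d) → ℝ) (h : ℝ)
    (X : Fin n → EuclideanSpace ℝ (Fin d)) (x : EuclideanSpace ℝ (Fin d)) : ℝ :=
  1 / ((n : ℝ) * h ^ d) * ∑ i, K (h⁻¹ • (x - X i))

/-- The point-wise expectation `p_h(x) = 𝔼[p̂_h(x)]` of the estimator
(for `n ≥ 1` it does not depend on `n`). -/
def kdeMean {d : ℕ} (P : Measure (EuclideanSpace ℝ (Fin d)))
    (K : EuclideanSpace ℝ (Fin d) → ℝ) (n : ℕ) (h : ℝ) (x : EuclideanSpace ℝ (Fin d)) : ℝ :=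
  ∫ X, kde K h X x ∂(sampleLaw P n)

/-- `sup_{x ∈ 𝕏} |p̂_h(x) - p_h(x)|`, as an element of `[0, ∞]`. -/
def supDeviation {d n : ℕ} (𝕏 : Set (EuclideanSpace ℝ (Fin d)))
    (P : Measure (EuclideanSpace ℝ (Fin d))) (K : EuclideanSpace ℝ (Fin d) → ℝ) (h : ℝ)
    (X : Fin n → EuclideanSpace ℝ (Fin d)) : ENNReal :=
  ⨆ x ∈ 𝕏, ENNReal.ofReal |kde K h X x - kdeMean P K n h x|

end KernelDensity

end

/-! The supremum is at least the deviation at one point `x` where the mass of small balls is at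
least of order `r ^ d_vol`. There the deviation is a centred i.i.d. sum of `Y = K((x - X) / h)`,
divided by `n h ^ d`, and it suffices that this sum does not concentrate. Esseen's inequality
(`measureReal_abs_le_le_integral_norm_charFun`) and a Gaussian bound on the characteristic function
show that the sum lies in a given interval of half-length `l ≥ sup |K|` with probability `O(l / √(n
v))`, where `v` bounds `𝔼(Y - Y')²` from below for an independent copy `Y'`
(`measureReal_abs_sum_sub_le_le`). One may take `v` of order `h ^ d_vol`
(`exists_variation_lower_bound`), so `l` of order `√(n h ^ d_vol)` gives the rate. -/

/-! ### Anti-concentration of i.i.d. sums -/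

/-- The squared modulus of a characteristic function is the one of the symmetrized variable. -/
theorem sq_norm_integral_cexp_eq {Ω : Type*} [MeasurableSpace Ω] (μ : Measure Ω)
    [IsProbabilityMeasure μ] {f : Ω → ℝ} (hf : Measurable f) :
    ‖∫ x, Complex.exp (f x * Complex.I) ∂μ‖ ^ 2 =
      ∫ z, Real.cos (f z.1 - f z.2) ∂(μ.prod μ) := by
  have hint : Integrable (fun z : Ω × Ω =>
      Complex.exp ((f z.1 - f z.2 : ℝ) * Complex.I)) (μ.prod μ) := by
    refine Integrable.of_bound (C := 1) (by fun_prop) (ae_of_all _ fun z => ?_)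
    rw [Complex.norm_exp_ofReal_mul_I]
  have h1 : (∫ x, Complex.exp (f x * Complex.I) ∂μ) *
      (starRingEnd ℂ) (∫ x, Complex.exp (f x * Complex.I) ∂μ) =
      ∫ z, Complex.exp ((f z.1 - f z.2 : ℝ) * Complex.I) ∂(μ.prod μ) := by
    rw [← integral_conj, ← integral_prod_mul]
    congr 1 with z
    rw [← Complex.exp_conj, ← Complex.exp_add]
    congr 1
    simp
    ring
  have h2 : ‖∫ x, Complex.exp (f x * Complex.I) ∂μ‖ ^ 2 =
      (∫ z, Complex.exp ((f z.1 - f z.2 : ℝ) * Complex.I) ∂(μ.prod μ)).re := by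
    rw [← h1, Complex.mul_conj, Complex.ofReal_re, Complex.normSq_eq_norm_sq]
  rw [h2, ← RCLike.re_eq_complex_re, ← integral_re hint]
  simp only [RCLike.re_eq_complex_re, Complex.exp_ofReal_mul_I_re]

/-- Symmetrize, use `cos y ≤ 1 - 2 y² / π²` for `|y| ≤ π`, then `1 - t ≤ exp (-t)`; the square root
halves the exponent. -/
theorem norm_integral_cexp_le {Ω : Type*} [MeasurableSpace Ω] (μ : Measure Ω)
    [IsProbabilityMeasure μ] {f : Ω → ℝ} (hf : Measurable f) {M u : ℝ}
    (hM : ∀ x, |f x| ≤ M) (hu : |u| * M ≤ 1) :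
    ‖∫ x, Complex.exp ((u * f x : ℝ) * Complex.I) ∂μ‖ ≤
      Real.exp (-(u ^ 2 * ∫ z, (f z.1 - f z.2) ^ 2 ∂(μ.prod μ)) / Real.pi ^ 2) := by
  have hpi := Real.pi_pos
  have hb : ∀ z : Ω × Ω, |f z.1 - f z.2| ≤ 2 * M := fun z =>
    (abs_sub _ _).trans (by linarith [hM z.1, hM z.2])
  have hi : Integrable (fun z : Ω × Ω => (f z.1 - f z.2) ^ 2) (μ.prod μ) := by
    refine Integrable.of_bound (C := (2 * M) ^ 2) (by fun_prop) (ae_of_all _ fun z => ?_)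
    rw [norm_pow]
    exact pow_le_pow_left₀ (norm_nonneg _) (hb z) 2
  have hsq : ‖∫ x, Complex.exp ((u * f x : ℝ) * Complex.I) ∂μ‖ ^ 2 ≤
      1 - 2 / Real.pi ^ 2 * (u ^ 2 * ∫ z, (f z.1 - f z.2) ^ 2 ∂(μ.prod μ)) := by
    rw [sq_norm_integral_cexp_eq μ (by fun_prop)]
    calc _ ≤ ∫ z, (1 - 2 / Real.pi ^ 2 * u ^ 2 * (f z.1 - f z.2) ^ 2) ∂(μ.prod μ) := by
          refine integral_mono ?_ ?_ fun z => ?_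
          · refine Integrable.of_bound (C := 1) (by fun_prop) (ae_of_all _ fun z => ?_)
            exact Real.abs_cos_le_one _
          · exact (integrable_const _).sub (hi.const_mul _)
          · have := Real.cos_le_one_sub_mul_cos_sq (x := u * f z.1 - u * f z.2) (by
              rw [← mul_sub, abs_mul]
              have := mul_le_mul_of_nonneg_left (hb z) (abs_nonneg u)
              linarith [Real.pi_gt_three])
            refine this.trans (le_of_eq ?_)
            ring
      _ = _ := by
          rw [integral_sub (integrable_const _) (hi.const_mul _), integral_const_mul]
          simp
          ring
  refine le_of_sq_le_sq ?_ (Real.exp_pos _).le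
  refine hsq.trans ?_
  rw [← Real.exp_nat_mul]
  refine le_trans (le_of_eq ?_) (Real.add_one_le_exp _)
  push_cast
  ring

/-- By independence the integral factorizes; the shift `b` contributes only a phase. -/
theorem norm_integral_pi_cexp_le {Ω : Type*} [MeasurableSpace Ω] (μ : Measure Ω)
    [IsProbabilityMeasure μ] {f : Ω → ℝ} (hf : Measurable f) {M u : ℝ}
    (hM : ∀ x, |f x| ≤ M) (hu : |u| * M ≤ 1) (n : ℕ) (b : ℝ) :
    ‖∫ X : Fin n → Ω, Complex.exp ((u * (∑ i, f (X i) - b) : ℝ) * Complex.I)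
        ∂(Measure.pi fun _ => μ)‖ ≤
      Real.exp (-(n * (∫ z, (f z.1 - f z.2) ^ 2 ∂(μ.prod μ)) / Real.pi ^ 2 * u ^ 2)) := by
  have h1 : ∀ X : Fin n → Ω, Complex.exp ((u * (∑ i, f (X i) - b) : ℝ) * Complex.I) =
      Complex.exp ((-(u * b) : ℝ) * Complex.I) *
        ∏ i, Complex.exp ((u * f (X i) : ℝ) * Complex.I) := fun X => by
    rw [← Complex.exp_sum, ← Complex.exp_add, ← Finset.sum_mul, ← add_mul,
      ← Complex.ofReal_sum, ← Complex.ofReal_add, ← Finset.mul_sum]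
    congr 3
    ring
  simp_rw [h1]
  rw [integral_const_mul, norm_mul, Complex.norm_exp_ofReal_mul_I, one_mul,
    integral_fintype_prod_eq_pow (fun x => Complex.exp ((u * f x : ℝ) * Complex.I)), norm_pow]
  refine (pow_le_pow_left₀ (norm_nonneg _) (norm_integral_cexp_le μ hf hM hu) _).trans ?_
  rw [← Real.exp_nat_mul, Fintype.card_fin]
  refine le_of_eq ?_
  congr 1
  ring

theorem one_half_le_norm_integral_cexp {x : ℝ} (hx : |x| ≤ 1) :
    1 / 2 ≤ ‖∫ s, Complex.exp ((s * x : ℝ) * Complex.I)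
      ∂(volume.restrict (Set.Icc (0 : ℝ) 1))‖ := by
  have hp : IsProbabilityMeasure (volume.restrict (Set.Icc (0 : ℝ) 1)) := ⟨by simp⟩
  have hint : Integrable (fun s : ℝ => Complex.exp ((s * x : ℝ) * Complex.I))
      (volume.restrict (Set.Icc (0 : ℝ) 1)) := by
    refine Integrable.of_bound (C := 1) (by fun_prop) (ae_of_all _ fun z => ?_)
    rw [Complex.norm_exp_ofReal_mul_I]
  refine le_trans ?_ (Complex.re_le_norm _)
  rw [← RCLike.re_eq_complex_re, ← integral_re hint]
  simp only [RCLike.re_eq_complex_re, Complex.exp_ofReal_mul_I_re]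
  have : (1 / 2 : ℝ) = ∫ _s, (1 / 2 : ℝ) ∂(volume.restrict (Set.Icc (0 : ℝ) 1)) := by simp
  rw [this]
  refine integral_mono_ae (integrable_const _) ?_ ?_
  · refine Integrable.of_bound (C := 1) (by fun_prop) (ae_of_all _ fun z => ?_)
    exact Real.abs_cos_le_one _
  · filter_upwards [ae_restrict_mem measurableSet_Icc] with s hs
    have h1 := Real.one_sub_sq_div_two_le_cos (x := s * x)
    have h2 : (s * x) ^ 2 ≤ 1 := by
      rw [sq_le_one_iff_abs_le_one, abs_mul, abs_of_nonneg hs.1]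
      exact mul_le_one₀ hs.2 (abs_nonneg _) hx
    linarith

/-- An inequality of Esseen: concentration is controlled by the characteristic function. -/
theorem measureReal_abs_le_le_integral_norm_charFun {Ω : Type*} [MeasurableSpace Ω]
    (μ : Measure Ω) [IsProbabilityMeasure μ] {S : Ω → ℝ} (hS : Measurable S) {l : ℝ}
    (hl : 0 < l) :
    μ.real {ω | |S ω| ≤ l} ≤
      4 * ∫ z, ‖∫ ω, Complex.exp (((z.1 - z.2) / l * S ω : ℝ) * Complex.I) ∂μ‖
        ∂((volume.restrict (Set.Icc (0 : ℝ) 1)).prod (volume.restrict (Set.Icc (0 : ℝ) 1))) := by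
  set ν := volume.restrict (Set.Icc (0 : ℝ) 1) with hν
  have hp : IsProbabilityMeasure ν := ⟨by simp [hν]⟩
  have hA : MeasurableSet {ω | |S ω| ≤ l} := measurableSet_le (by fun_prop) (by fun_prop)
  have hcos : Integrable (fun q : Ω × (ℝ × ℝ) => Real.cos ((q.2.1 - q.2.2) / l * S q.1))
      (μ.prod (ν.prod ν)) :=
    Integrable.of_bound (C := 1) (by fun_prop) (ae_of_all _ fun z => Real.abs_cos_le_one _)
  have hexp : StronglyMeasurable (fun q : (ℝ × ℝ) × Ω =>
      Complex.exp (((q.1.1 - q.1.2) / l * S q.2 : ℝ) * Complex.I)) := by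
    apply Measurable.stronglyMeasurable
    fun_prop
  have hbound : ∀ z : ℝ × ℝ,
      ‖∫ ω, Complex.exp (((z.1 - z.2) / l * S ω : ℝ) * Complex.I) ∂μ‖ ≤ 1 := fun z => by
    refine (norm_integral_le_integral_norm _).trans ?_
    simp only [Complex.norm_exp_ofReal_mul_I]
    simp
  calc μ.real {ω | |S ω| ≤ l}
      = ∫ ω, Set.indicator {ω | |S ω| ≤ l} (fun _ => (1 : ℝ)) ω ∂μ := by
        rw [integral_indicator hA]; simp
    -- The inner integral is a squared modulus, hence nonnegative everywhere, and at least `(1 / 2)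
    -- ^ 2` where `|S ω| ≤ l`: this is the factor 4.
    _ ≤ ∫ ω, 4 * ∫ z, Real.cos ((z.1 - z.2) / l * S ω) ∂(ν.prod ν) ∂μ := by
        refine integral_mono ((integrable_const _).indicator hA)
          (hcos.integral_prod_left.const_mul 4) fun ω => ?_
        have h1 := sq_norm_integral_cexp_eq ν (f := fun s => s * (S ω / l)) (by fun_prop)
        have h2 : ∫ z, Real.cos ((z.1 - z.2) / l * S ω) ∂(ν.prod ν) =
            ∫ z, Real.cos (z.1 * (S ω / l) - z.2 * (S ω / l)) ∂(ν.prod ν) := by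
          congr 1 with z
          congr 1
          ring
        simp only
        rw [h2, ← h1]
        by_cases hω : |S ω| ≤ l
        · rw [Set.indicator_of_mem (by exact hω)]
          have h3 := one_half_le_norm_integral_cexp (x := S ω / l) (by
            rw [abs_div, abs_of_pos hl]
            exact (div_le_one hl).2 hω)
          have h4 := pow_le_pow_left₀ (by norm_num) h3 2
          linarith
        · rw [Set.indicator_of_notMem (by exact hω)]
          positivity
    _ = 4 * ∫ z, ∫ ω, Real.cos ((z.1 - z.2) / l * S ω) ∂μ ∂(ν.prod ν) := by
        rw [integral_const_mul, integral_integral_swap hcos]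
    _ ≤ _ := by
        refine mul_le_mul_of_nonneg_left ?_ (by norm_num)
        refine integral_mono hcos.integral_prod_right ?_ fun z => ?_
        · refine Integrable.of_bound (C := 1) ?_ (ae_of_all _ fun z => ?_)
          · exact (hexp.integral_prod_right).norm.aestronglyMeasurable
          · rw [norm_norm]; exact hbound z
        · have hint : Integrable
              (fun ω => Complex.exp (((z.1 - z.2) / l * S ω : ℝ) * Complex.I)) μ := by
            refine Integrable.of_bound (C := 1) (by fun_prop) (ae_of_all _ fun z => ?_)
            rw [Complex.norm_exp_ofReal_mul_I]
          refine le_trans (le_of_eq ?_) (Complex.re_le_norm _)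
          rw [← RCLike.re_eq_complex_re, ← integral_re hint]
          simp only [RCLike.re_eq_complex_re, Complex.exp_ofReal_mul_I_re]

/-- For each fixed second coordinate, the first is extended to the whole line. -/
theorem integral_exp_neg_mul_sub_sq_le {a : ℝ} (ha : 0 < a) :
    ∫ z : ℝ × ℝ, Real.exp (-a * (z.1 - z.2) ^ 2)
      ∂((volume.restrict (Set.Icc (0 : ℝ) 1)).prod (volume.restrict (Set.Icc (0 : ℝ) 1))) ≤
      √(Real.pi / a) := by
  set ν := volume.restrict (Set.Icc (0 : ℝ) 1) with hν
  have hp : IsProbabilityMeasure ν := ⟨by simp [hν]⟩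
  have hi : Integrable (fun z : ℝ × ℝ => Real.exp (-a * (z.1 - z.2) ^ 2)) (ν.prod ν) := by
    refine Integrable.of_bound (C := 1) (by fun_prop) (ae_of_all _ fun z => ?_)
    rw [Real.norm_eq_abs, Real.abs_exp, Real.exp_le_one_iff]
    nlinarith [sq_nonneg (z.1 - z.2)]
  rw [integral_prod_symm _ hi]
  have : √(Real.pi / a) = ∫ _t, √(Real.pi / a) ∂ν := by simp
  rw [this]
  refine integral_mono hi.integral_prod_right (integrable_const _) fun t => ?_
  simp only
  rw [← integral_gaussian a, ← integral_sub_right_eq_self (fun s => Real.exp (-a * s ^ 2)) t]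
  exact setIntegral_le_integral ((integrable_exp_neg_mul_sq ha).comp_sub_right t)
    (ae_of_all _ fun s => (Real.exp_pos _).le)

/-- Esseen's inequality only involves frequencies `|u| ≤ 1 / l`; `M ≤ l` keeps them where the
Gaussian bound is valid. -/
theorem measureReal_abs_sum_sub_le_le {Ω : Type*} [MeasurableSpace Ω] (μ : Measure Ω)
    [IsProbabilityMeasure μ] {f : Ω → ℝ} (hf : Measurable f) {M l : ℝ}
    (hM : ∀ x, |f x| ≤ M) (hl : 0 < l) (hMl : M ≤ l) {n : ℕ} (hn : 0 < n)
    {v : ℝ} (hv : 0 < v) (hvf : v ≤ ∫ z, (f z.1 - f z.2) ^ 2 ∂(μ.prod μ)) (b : ℝ) :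
    (Measure.pi fun _ : Fin n => μ).real {X | |∑ i, f (X i) - b| ≤ l} ≤
      4 * √(Real.pi ^ 3 * l ^ 2 / (n * v)) := by
  have hpi := Real.pi_pos
  have hn' : (0 : ℝ) < n := by exact_mod_cast hn
  have ha : 0 < n * v / (Real.pi ^ 2 * l ^ 2) := by positivity
  refine (measureReal_abs_le_le_integral_norm_charFun _
    (S := fun X : Fin n → Ω => ∑ i, f (X i) - b) (by fun_prop) hl).trans ?_
  refine mul_le_mul_of_nonneg_left ?_ (by norm_num)
  have heq : Real.pi ^ 3 * l ^ 2 / (n * v) = Real.pi / (n * v / (Real.pi ^ 2 * l ^ 2)) := by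
    field_simp
  rw [heq]
  refine le_trans ?_ (integral_exp_neg_mul_sub_sq_le ha)
  have hp : IsProbabilityMeasure (volume.restrict (Set.Icc (0 : ℝ) 1)) := ⟨by simp⟩
  refine integral_mono_of_nonneg (ae_of_all _ fun z => norm_nonneg _) ?_ ?_
  · refine Integrable.of_bound (C := 1) (by fun_prop) (ae_of_all _ fun z => ?_)
    rw [Real.norm_eq_abs, Real.abs_exp, Real.exp_le_one_iff]
    nlinarith [sq_nonneg (z.1 - z.2)]
  · rw [Measure.prod_restrict]
    filter_upwards [ae_restrict_mem (measurableSet_Icc.prod measurableSet_Icc)] with z hz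
    refine (norm_integral_pi_cexp_le μ hf hM ?_ n b).trans ?_
    · have h1 : |z.1 - z.2| ≤ 1 := by
        rw [abs_le]
        constructor <;> linarith [hz.1.1, hz.1.2, hz.2.1, hz.2.2]
      rw [abs_div, abs_of_pos hl, div_mul_eq_mul_div, div_le_one hl]
      nlinarith [abs_nonneg (z.1 - z.2)]
    · rw [Real.exp_le_exp, neg_mul, neg_le_neg_iff, div_pow]
      have h2 : n * v / (Real.pi ^ 2 * l ^ 2) * (z.1 - z.2) ^ 2 =
        n * v / Real.pi ^ 2 * ((z.1 - z.2) ^ 2 / l ^ 2) := by field_simp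
      rw [h2]
      gcongr

/-! ### Variation of the kernel at one point -/

namespace KernelDensity

variable {d : ℕ} {𝕏 : Set (EuclideanSpace ℝ (Fin d))} {P : Measure (EuclideanSpace ℝ (Fin d))}
  {K : EuclideanSpace ℝ (Fin d) → ℝ}

theorem exists_ball_lower_bound (hP : ExactLower 𝕏 P) :
    ∃ x ∈ 𝕏, ∃ c : ℝ, 0 < c ∧ ∃ r₀ : ℝ, 0 < r₀ ∧ ∀ r : ℝ, 0 < r → r < r₀ →
      ENNReal.ofReal (c * r ^ volDim 𝕏 P) ≤ P (Metric.ball x r) := by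
  obtain ⟨x, hx⟩ := lt_iSup_iff.1 hP
  obtain ⟨hx𝕏, hlim⟩ := lt_iSup_iff.1 hx
  obtain ⟨b, hb0, hb⟩ := ENNReal.lt_iff_exists_nnreal_btwn.1 hlim
  have hev := eventually_lt_of_lt_liminf hb
  obtain ⟨r₀, hr₀, hsub⟩ := mem_nhdsGT_iff_exists_Ioo_subset.1 hev
  refine ⟨x, hx𝕏, b, by exact_mod_cast hb0, r₀, hr₀, fun r hr hrr => ?_⟩
  have h1 : (b : ENNReal) < P (Metric.ball x r) / ENNReal.ofReal (r ^ volDim 𝕏 P) :=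
    hsub ⟨hr, hrr⟩
  rw [ENNReal.ofReal_mul b.coe_nonneg, ENNReal.ofReal_coe_nnreal]
  exact ENNReal.mul_le_of_le_div h1.le

/-- Some `ν > 0` is admissible, so the mass is at most `b * r ^ ν`, which tends to 0. -/
theorem exists_ball_measure_le_half (hdim : 0 < volDim 𝕏 P)
    {x : EuclideanSpace ℝ (Fin d)} (hx : x ∈ 𝕏) :
    ∃ r₀ : ℝ, 0 < r₀ ∧ ∀ r : ℝ, 0 < r → r < r₀ → P (Metric.ball x r) ≤ 2⁻¹ := by
  -- As `sSup ∅ = 0` in the reals, `hdim` rules out the empty set.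
  have hne : {ν : ℝ | 0 ≤ ν ∧ upperBallRate 𝕏 P ν < ⊤}.Nonempty := by
    by_contra h
    rw [Set.not_nonempty_iff_eq_empty] at h
    rw [volDim, h, Real.sSup_empty] at hdim
    exact lt_irrefl _ hdim
  obtain ⟨ν, ⟨-, hν⟩, hν0⟩ := exists_lt_of_lt_csSup hne hdim
  obtain ⟨b, hb, -⟩ := ENNReal.lt_iff_exists_nnreal_btwn.1 hν
  have hev := eventually_lt_of_limsup_lt hb
  have htend : Tendsto (fun r : ℝ => (b : ℝ) * r ^ ν) (𝓝[>] 0) (𝓝 0) := by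
    have : ContinuousAt (fun r : ℝ => (b : ℝ) * r ^ ν) 0 :=
      continuousAt_const.mul (Real.continuousAt_rpow_const _ _ (Or.inr hν0.le))
    have h2 := this.tendsto
    rw [Real.zero_rpow hν0.ne', mul_zero] at h2
    exact h2.mono_left nhdsWithin_le_nhds
  have hev2 := htend.eventually (gt_mem_nhds (show (0 : ℝ) < 2⁻¹ by norm_num))
  obtain ⟨r₀, hr₀, hsub⟩ := mem_nhdsGT_iff_exists_Ioo_subset.1 (hev.and hev2)
  refine ⟨r₀, hr₀, fun r hr hrr => ?_⟩
  obtain ⟨h1, h2⟩ := hsub ⟨hr, hrr⟩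
  have h3 : P (Metric.ball x r) / ENNReal.ofReal (r ^ ν) ≤ b :=
    (le_iSup₂ (f := fun x (_ : x ∈ 𝕏) => P (Metric.ball x r) / ENNReal.ofReal (r ^ ν)) x hx).trans
      h1.le
  have h4 : ENNReal.ofReal (r ^ ν) ≠ 0 := by
    rw [Ne, ENNReal.ofReal_eq_zero, not_le]
    exact Real.rpow_pos_of_pos hr ν
  rw [ENNReal.div_le_iff h4 ENNReal.ofReal_ne_top, ← ENNReal.ofReal_coe_nnreal,
    ← ENNReal.ofReal_mul b.coe_nonneg] at h3
  refine h3.trans ((ENNReal.ofReal_le_ofReal h2.le).trans (le_of_eq ?_))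
  rw [ENNReal.ofReal_inv_of_pos two_pos, ENNReal.ofReal_ofNat]

/-- Otherwise the integral dominates `κ ∫₀^∞ t ^ (d_vol - 1) dt`, which diverges. -/
theorem KernelIntegrable.exists_forall_norm_ge_abs_lt (hdim : 0 < volDim 𝕏 P)
    (hK : KernelIntegrable 𝕏 P K 1) {κ : ℝ} (hκ : 0 < κ) :
    ∃ T : ℝ, 0 < T ∧ ∀ x, T ≤ ‖x‖ → |K x| < κ := by
  by_contra! hcon
  have hint := hK.2.resolve_left hdim.ne'
  refine not_integrableOn_Ioi_rpow (volDim 𝕏 P - 1) ⟨by fun_prop, ?_⟩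
  have hle : ENNReal.ofReal κ *
      ∫⁻ t in Set.Ioi (0 : ℝ), ENNReal.ofReal (t ^ (volDim 𝕏 P - 1)) < ⊤ := by
    refine lt_of_le_of_lt ?_ hint
    rw [← lintegral_const_mul _ (by fun_prop)]
    refine setLIntegral_mono' measurableSet_Ioi fun t ht => ?_
    rw [mul_comm]
    refine mul_le_mul_right ?_ _
    obtain ⟨x, hx, hKx⟩ := hcon t ht
    refine le_trans ?_ (le_iSup₂ (f := fun (x : EuclideanSpace ℝ (Fin d)) (_ : t ≤ ‖x‖) =>
      ENNReal.ofReal (|K x| ^ (1 : ℝ))) x hx)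
    rw [Real.rpow_one]
    exact ENNReal.ofReal_le_ofReal hKx
  have hfin := ENNReal.lt_top_of_mul_ne_top_right hle.ne (by simpa using hκ)
  refine lt_of_le_of_lt (le_of_eq ?_) hfin
  refine setLIntegral_congr_fun measurableSet_Ioi fun t ht => ?_
  exact Real.enorm_of_nonneg (Real.rpow_nonneg (le_of_lt ht) _)

theorem PositiveNearOrigin.exists_le (hK : PositiveNearOrigin K) {M : ℝ}
    (hM : ∀ x, |K x| ≤ M) :
    ∃ κ : ℝ, 0 < κ ∧ ∃ τ : ℝ, 0 < τ ∧ ∀ x, ‖x‖ ≤ τ → κ ≤ K x := by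
  obtain ⟨L, hL, hlim⟩ := hK
  have hev := hlim.eventually (lt_mem_nhds (half_lt_self hL))
  obtain ⟨τ, hτ, hτ0⟩ := (hev.and self_mem_nhdsWithin).exists
  refine ⟨L / 2, half_pos hL, τ, hτ0, fun x hx => hτ.le.trans ?_⟩
  exact ciInf_le (f := fun x : Metric.closedBall (0 : EuclideanSpace ℝ (Fin d)) τ => K x)
    ⟨-M, by rintro _ ⟨y, rfl⟩; exact (abs_le.1 (hM y)).1⟩ ⟨x, by simpa using hx⟩

/-- On `s ×ˢ t` the two values differ by at least `κ / 2`. -/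
theorem le_integral_sub_sq {Ω : Type*} [MeasurableSpace Ω] (μ : Measure Ω)
    [IsProbabilityMeasure μ] {f : Ω → ℝ} (hf : Measurable f) {M κ : ℝ}
    (hM : ∀ x, |f x| ≤ M) (hκ : 0 < κ) {s t : Set Ω} (hs : MeasurableSet s)
    (ht : MeasurableSet t) (hfs : ∀ x ∈ s, κ ≤ f x) (hft : ∀ x ∈ t, |f x| < κ / 2) :
    (κ / 2) ^ 2 * (μ.real s * μ.real t) ≤ ∫ z, (f z.1 - f z.2) ^ 2 ∂(μ.prod μ) := by
  have hst := hs.prod ht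
  rw [← measureReal_prod_prod, mul_comm, ← smul_eq_mul, ← integral_indicator_const _ hst]
  refine integral_mono ((integrable_const _).indicator hst) ?_ fun z => ?_
  · refine Integrable.of_bound (C := (2 * M) ^ 2) (by fun_prop) (ae_of_all _ fun z => ?_)
    rw [norm_pow]
    exact pow_le_pow_left₀ (norm_nonneg _)
      ((abs_sub _ _).trans (by linarith [hM z.1, hM z.2])) 2
  · by_cases hz : z ∈ s ×ˢ t
    · rw [Set.indicator_of_mem hz]
      have h1 := hfs _ hz.1
      have h2 := (abs_lt.1 (hft _ hz.2)).2
      exact pow_le_pow_left₀ (by positivity) (by linarith) 2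
    · rw [Set.indicator_of_notMem hz]
      positivity

theorem exists_variation_lower_bound [IsProbabilityMeasure P] (hP : ExactLower 𝕏 P)
    (hdim : 0 < volDim 𝕏 P) (hKmeas : Measurable K) (hKint : KernelIntegrable 𝕏 P K 1)
    (hKpos : PositiveNearOrigin K) :
    ∃ x ∈ 𝕏, ∃ c : ℝ, 0 < c ∧ ∃ h₀ : ℝ, 0 < h₀ ∧ ∀ h : ℝ, 0 < h → h ≤ h₀ →
      c * h ^ volDim 𝕏 P ≤
        ∫ z, (K (h⁻¹ • (x - z.1)) - K (h⁻¹ • (x - z.2))) ^ 2 ∂(P.prod P) := by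
  obtain ⟨M, hM⟩ := hKint.1
  obtain ⟨x, hx, c, hc, r₁, hr₁, hlow⟩ := exists_ball_lower_bound hP
  obtain ⟨r₂, hr₂, hup⟩ := exists_ball_measure_le_half hdim hx
  obtain ⟨κ, hκ, τ, hτ, hnear⟩ := hKpos.exists_le hM
  obtain ⟨T, hT, hfar⟩ := hKint.exists_forall_norm_ge_abs_lt hdim (half_pos hκ)
  -- Squared gap, times the mass of the ball of radius `h * τ`, where the kernel is at least `κ`,
  -- times the mass at least `1 / 2` off the ball of radius `h * T`, where it is below `κ / 2`.
  refine ⟨x, hx, (κ / 2) ^ 2 * (c * τ ^ volDim 𝕏 P * (1 / 2)), by positivity,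
    min (r₁ / (2 * τ)) (r₂ / (2 * T)), by positivity, fun h hh hle => ?_⟩
  have hb1 : h * τ < r₁ := by
    have h2 := (le_div_iff₀ (by positivity)).1 (hle.trans (min_le_left _ _))
    have : 0 < h * τ := by positivity
    linarith
  have hb2 : h * T < r₂ := by
    have h2 := (le_div_iff₀ (by positivity)).1 (hle.trans (min_le_right _ _))
    have : 0 < h * T := by positivity
    linarith
  have hnorm : ∀ y, ‖h⁻¹ • (x - y)‖ = dist y x / h := fun y => by
    rw [norm_smul, norm_inv, Real.norm_of_nonneg hh.le, ← dist_eq_norm, dist_comm, div_eq_inv_mul]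
  refine le_trans ?_ (le_integral_sub_sq P (f := fun y => K (h⁻¹ • (x - y))) (by fun_prop)
    (fun y => hM _) hκ (s := Metric.ball x (h * τ)) (t := (Metric.ball x (h * T))ᶜ)
    measurableSet_ball measurableSet_ball.compl (fun y hy => ?_) fun y hy => ?_)
  · have h1 : c * (h * τ) ^ volDim 𝕏 P ≤ P.real (Metric.ball x (h * τ)) :=
      (ENNReal.ofReal_le_iff_le_toReal (measure_ne_top _ _)).1 (hlow _ (by positivity) hb1)
    have h2 : 1 / 2 ≤ P.real (Metric.ball x (h * T))ᶜ := by
      rw [probReal_compl_eq_one_sub measurableSet_ball]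
      have h3 := ENNReal.toReal_mono (by simp) (hup _ (by positivity) hb2)
      rw [ENNReal.toReal_inv, ENNReal.toReal_ofNat] at h3
      rw [Measure.real]
      linarith
    rw [Real.mul_rpow hh.le hτ.le] at h1
    have h3 := mul_le_mul h1 h2 (by norm_num) measureReal_nonneg
    have h4 := mul_le_mul_of_nonneg_left h3 (sq_nonneg (κ / 2))
    refine le_trans (le_of_eq ?_) h4
    ring
  · refine hnear _ ?_
    rw [hnorm, div_le_iff₀ hh, mul_comm]
    exact (Metric.mem_ball.1 hy).le
  · refine hfar _ ?_
    rw [hnorm, le_div_iff₀ hh, mul_comm]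
    simpa using hy

end KernelDensity

/-! ### The lower bound for the supremum deviation -/

theorem mainTheorem4 {d : ℕ} (𝕏 : Set (EuclideanSpace ℝ (Fin d)))
    (P : Measure (EuclideanSpace ℝ (Fin d))) [IsProbabilityMeasure P]
    (hP : KernelDensity.ExactLower 𝕏 P) (hdim : 0 < KernelDensity.volDim 𝕏 P)
    (K : EuclideanSpace ℝ (Fin d) → ℝ) (hKmeas : Measurable K)
    (hKint : KernelDensity.KernelIntegrable 𝕏 P K 1)
    (hKpos : KernelDensity.PositiveNearOrigin K) :
    ∃ h₀ : ℝ, 0 < h₀ ∧ ∀ δ : ℝ, 0 < δ → δ < 1 →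
      ∃ C : ℝ, 0 < C ∧ ∀ h : ℕ → ℝ, (∀ n, 0 < h n) →
        Tendsto (fun n : ℕ => (n : ℝ) * h n ^ KernelDensity.volDim 𝕏 P) atTop atTop →
        ∃ N : ℕ, ∀ n : ℕ, N ≤ n → h n ≤ h₀ →
          ∃ A : Set (Fin n → EuclideanSpace ℝ (Fin d)), MeasurableSet A ∧
            ENNReal.ofReal (1 - δ) ≤ KernelDensity.sampleLaw P n A ∧
            ∀ X ∈ A,
              ENNReal.ofReal (C * √(1 / ((n : ℝ) *
                  h n ^ (2 * (d : ℝ) - KernelDensity.volDim 𝕏 P)))) ≤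
                KernelDensity.supDeviation 𝕏 P K (h n) X := by
  obtain ⟨M, hM⟩ := hKint.1
  obtain ⟨x, hx, c, hc, h₀, hh₀, hvar⟩ :=
    KernelDensity.exists_variation_lower_bound hP hdim hKmeas hKint hKpos
  set V := KernelDensity.volDim 𝕏 P with hV
  have hpi := Real.pi_pos
  refine ⟨h₀, hh₀, fun δ hδ _ => ?_⟩
  -- `C` makes the anti-concentration bound at the scale `l` below equal to `δ`.
  obtain ⟨C, hC, hCδ⟩ : ∃ C : ℝ, 0 < C ∧ 4 * √(Real.pi ^ 3 * C ^ 2 / c) = δ := by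
    refine ⟨δ / 4 * √(c / Real.pi ^ 3), by positivity, ?_⟩
    rw [mul_pow, Real.sq_sqrt (by positivity)]
    have : Real.pi ^ 3 * ((δ / 4) ^ 2 * (c / Real.pi ^ 3)) / c = (δ / 4) ^ 2 := by
      field_simp
    rw [this, Real.sqrt_sq (by positivity)]
    ring
  refine ⟨C, hC, fun h hh hlim => ?_⟩
  -- The divergence of `n h ^ V` serves only to reach `M ≤ l`.
  obtain ⟨N, hN⟩ := eventually_atTop.1 ((hlim.eventually_ge_atTop ((M / C) ^ 2)).and
    (eventually_gt_atTop 0))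
  refine ⟨N, fun n hn hle => ?_⟩
  obtain ⟨hMn, hn0⟩ := hN n hn
  have hn' : (0 : ℝ) < n := by exact_mod_cast hn0
  have hhn := hh n
  have hhV : 0 < h n ^ V := Real.rpow_pos_of_pos hhn V
  set l := C * √(n * h n ^ V) with hl
  have hl0 : 0 < l := by positivity
  have hMl : M ≤ l := by
    rw [hl, ← div_le_iff₀' hC]
    exact Real.le_sqrt_of_sq_le hMn
  -- The anti-concentration bound is uniform in the centre, so the mean is never computed.
  set b := n * h n ^ d * KernelDensity.kdeMean P K n (h n) x with hb
  have hmeas : Measurable fun X : Fin n → EuclideanSpace ℝ (Fin d) =>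
      |∑ i, K ((h n)⁻¹ • (x - X i)) - b| := by fun_prop
  have hB := measurableSet_le hmeas (measurable_const (a := l))
  have hprob := measureReal_abs_sum_sub_le_le P (f := fun y => K ((h n)⁻¹ • (x - y)))
    (by fun_prop) (fun y => hM _) hl0 hMl hn0 (mul_pos hc hhV) (hvar _ hhn hle) b
  have hval : Real.pi ^ 3 * l ^ 2 / (n * (c * h n ^ V)) = Real.pi ^ 3 * C ^ 2 / c := by
    rw [hl, mul_pow, Real.sq_sqrt (by positivity)]
    field_simp
  rw [hval, hCδ] at hprob
  refine ⟨_, hB.compl, ?_, fun X hX => ?_⟩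
  · rw [KernelDensity.sampleLaw, ENNReal.ofReal_le_iff_le_toReal (measure_ne_top _ _),
      ← Measure.real, probReal_compl_eq_one_sub hB]
    linarith
  · have hX' : l < |∑ i, K ((h n)⁻¹ • (x - X i)) - b| := not_le.1 hX
    refine le_trans (ENNReal.ofReal_le_ofReal ?_)
      (le_iSup₂ (f := fun x (_ : x ∈ 𝕏) => ENNReal.ofReal
        |KernelDensity.kde K (h n) X x - KernelDensity.kdeMean P K n (h n) x|) x hx)
    have hnd : 0 < n * h n ^ d := by positivity
    have h1 : KernelDensity.kde K (h n) X x - KernelDensity.kdeMean P K n (h n) x =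
        (∑ i, K ((h n)⁻¹ • (x - X i)) - b) / (n * h n ^ d) := by
      rw [KernelDensity.kde, hb]
      field_simp
    have h2 : 1 / (n * h n ^ (2 * (d : ℝ) - V)) = (n * h n ^ V) / (n * h n ^ d) ^ 2 := by
      rw [Real.rpow_sub hhn, mul_comm 2 (d : ℝ), Real.rpow_mul hhn.le, Real.rpow_natCast,
        Real.rpow_ofNat]
      field_simp
    rw [h1, h2, abs_div, abs_of_pos hnd, Real.sqrt_div' _ (by positivity),
      Real.sqrt_sq hnd.le, ← mul_div_assoc]
    gcongr
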